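/- Let $l,m$ be positive even integers and consider the square lattice on the $l\times m$ torus, with vertices $(\xi,\eta)\in\mathbb Z/l\times\mathbb Z/m$; call a vertex white if $\xi+\eta$ is even and black otherwise. Each white vertex $(\xi,\eta)$ is the end of four links: an $A$-link to $(\xi+1,\eta)$, a $B$-link to $(\xi,\eta+1)$, a $C$-link to $(\xi,\eta-1)$ and a $D$-link to $(\xi-1,\eta)$ (if $l=2$ or $m=2$, parallel links are distinct links). Attach to the links arbitrary complex numbers, written $a$, $b$, $c$, $d$ on $A$-, $B$-, $C$-, $D$-links respectively and depending on the link, with all $b\neq0$. Let $A,B,C,D$ be the linear operators from $\mathbb C^{\{\text{white vertices}\}}$ to $\mathbb C^{\{\text{black vertices}\}}$ whose matrix entries are these numbers (the basis vector of a white vertex is sent to the multiple, by the number on its link of the given kind, of the basis vector of the black end of that link); $B$ is then invertible. Put $$\mathcal F(u,v)=\det\bigl(1+uAB^{-1}-vDB^{-1}-uvCB^{-1}\bigr).$$ Let $\mathcal S(u,v)$ be the normalized statistical sum of the dimer model: the product of $-b^{-1}$ over all $B$-links, times the sum over all dimer configurations (sets of links such that every vertex is an end of exactly one link of the set) of the product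 of the weights $ua$, $-b$, $-uvc$, $-vd$ of the $A$-, $B$-, $C$-, $D$-links of the configuration. A closed lattice path on the torus yields a monomial $u^{\alpha}v^{\beta}$, namely the part depending on $u,v$ of the product of the link weights along it, where a link traversed from its black to its white end contributes the inverse of its weight. Let $\mathbf a,\mathbf b$ be basis cycles, i.e. closed lattice paths with intersection number $1$ (for some orientation of the torus), and let $x=u^{\alpha_1}v^{\beta_1}$ and $y=u^{\alpha_2}v^{\beta_2}$ be the monomials that they yield. Then there are unique Laurent polynomials $f,s$ in two variables over $\mathbb C$ such that, for all nonzero $u,v\in\mathbb C$, $$f(u^{\alpha_1}v^{\beta_1},u^{\alpha_2}v^{\beta_2})=\mathcal F(u,v),\qquad s(u^{\alpha_1}v^{\beta_1},u^{\alpha_2}v^{\beta_2})=\mathcal S(u,v),$$ and they satisfy $$s(x,y)=\tfrac12\bigl(-f(x,y)+f(-x,y)+f(x,-y)+f(-x,-y)\bigr),$$ $$f(x,y)=\tfrac12\bigl(-s(x,y)+s(-x,y)+s(x,-y)+s(-x,-y)\bigr)$$ for all $x,y$. Moreover, the basis cycles $\mathbf a,\mathbf b$ can be chosen, depending only on $l$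 and $m$, so that $f$ and $s$ are polynomials, i.e. have no negative exponents, for all values of $a,b,c,d$ with all $b\ne0$. -/

import Mathlib

noncomputable section

namespace DimerTorus

/-- Vertices `(ξ, η)` of the square lattice on the `l × m` torus. -/
abbrev Vertex (l m : ℕ) : Type := ZMod l × ZMod m

/-- Checkerboard colouring (used for even `l` and `m`): the white vertices, `ξ + η` even, carry the
one-dimensional summands of `H₁`; all the other (black) vertices carry those of `H₂`. -/
abbrev IsWhite {l m : ℕ} (p : Vertex l m) : Prop := Even (p.1.val + p.2.val)

abbrev White (l m : ℕ) : Type := {p : Vertex l m // IsWhite p}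

abbrev Black (l m : ℕ) : Type := {p : Vertex l m // ¬ IsWhite p}

/-- The four kinds of links, named after the operator whose blocks they carry. -/
inductive Kind : Type
  | A | B | C | D
  deriving DecidableEq

instance : Fintype Kind where
  elems := {.A, .B, .C, .D}
  complete k := by cases k <;> decide

/-- The displacement from the white end of a link to its black end:
`A` goes right, `B` up, `C` down, `D` left. -/
def Kind.step : Kind → ℤ × ℤ
  | .A => (1, 0)
  | .B => (0, 1)
  | .C => (0, -1)
  | .D => (-1, 0)

/-- The exponents of `u` and `v` in the weight of a link: `ua`, `b`, `uvc`, `vd`. -/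
def Kind.degree : Kind → ℤ × ℤ
  | .A => (1, 0)
  | .B => (0, 0)
  | .C => (1, 1)
  | .D => (0, 1)

/-- A link is given by its white end and its kind. (If `l = 2` or `m = 2`, parallel links with the
same two ends are different links.) -/
abbrev Link (l m : ℕ) : Type := White l m × Kind

/-- The white end of a link. -/
def Link.source {l m : ℕ} (e : Link l m) : Vertex l m := e.1.1

/-- The black end of a link. -/
def Link.target {l m : ℕ} (e : Link l m) : Vertex l m :=
  (e.1.1.1 + (e.2.step.1 : ZMod l), e.1.1.2 + (e.2.step.2 : ZMod m))

/-! ### The operators and the determinant -/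

section Operators

variable {l m : ℕ}

/-- The operator `A`, `B`, `C` or `D` from `H₁` to `H₂`, as a matrix: its only entries are the
numbers `w e` attached to the links `e` of the given kind. -/
def blockOp (w : Link l m → ℂ) (k : Kind) : Matrix (Black l m) (White l m) ℂ :=
  fun q p => if q.1 = Link.target (p, k) then w (p, k) else 0

/-- The operator `B⁻¹` from `H₂` to `H₁`; see `blockOp_B_mul_invB` and `invB_mul_blockOp_B`. -/
def invB (w : Link l m → ℂ) : Matrix (White l m) (Black l m) ℂ :=
  fun p q => if q.1 = Link.target (p, Kind.B) then (w (p, Kind.B))⁻¹ else 0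

lemma even_val_iff {n : ℕ} [NeZero n] (hn : Even n) (a : ZMod n) :
    Even (a + 1).val ↔ ¬ Even a.val := by
  have h2 : 2 ∣ n := hn.two_dvd
  have key : ∀ b : ZMod n, Even b.val ↔ ZMod.castHom h2 (ZMod 2) b = 0 := by
    intro b
    rw [ZMod.castHom_apply, ZMod.cast_eq_val, ZMod.natCast_eq_zero_iff_even]
  rw [key, key, map_add, map_one]
  generalize ZMod.castHom h2 (ZMod 2) a = c
  revert c
  decide

lemma isWhite_add_one {l m : ℕ} [NeZero m] (hm : Even m) (x : ZMod l) (y : ZMod m) :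
    IsWhite (x, y + 1) ↔ ¬ IsWhite (x, y) := by
  simp only [IsWhite, Nat.even_add, even_val_iff hm]
  tauto

lemma target_B (p : White l m) :
    Link.target (p, Kind.B) = (p.1.1, p.1.2 + 1) := by
  simp [Link.target, Kind.step]

lemma target_B_injective {p p' : White l m}
    (h : Link.target (p, Kind.B) = Link.target (p', Kind.B)) : p = p' := by
  rw [target_B, target_B, Prod.mk.injEq, add_left_inj] at h
  exact Subtype.ext (Prod.ext h.1 h.2)

lemma target_B_surjective [NeZero m] (hm : Even m) (q : Black l m) :
    ∃ p : White l m, q.1 = Link.target (p, Kind.B) := by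
  have h : IsWhite (q.1.1, q.1.2 - 1) := by
    by_contra hc
    have := (isWhite_add_one hm q.1.1 (q.1.2 - 1)).2 hc
    rw [sub_add_cancel] at this
    exact q.2 this
  exact ⟨⟨_, h⟩, by rw [target_B]; simp⟩

lemma target_B_black [NeZero m] (hm : Even m) (p : White l m) :
    ¬ IsWhite (Link.target (p, Kind.B)) := by
  rw [target_B, isWhite_add_one hm, not_not]
  exact p.2

lemma blockOp_B_mul_invB [NeZero l] [NeZero m] (hm : Even m) (w : Link l m → ℂ)
    (hw : ∀ p, w (p, Kind.B) ≠ 0) : blockOp w Kind.B * invB w = 1 := by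
  ext q q'
  obtain ⟨p, hp⟩ := target_B_surjective hm q
  rw [Matrix.mul_apply, Finset.sum_eq_single p]
  · by_cases h : q = q'
    · subst h
      simp [blockOp, invB, hp, hw p]
    · have h' : ¬ q'.1 = Link.target (p, Kind.B) := fun h2 => h (Subtype.ext (hp.trans h2.symm))
      simp [invB, h', h]
  · intro p' _ hne
    have h' : ¬ q.1 = Link.target (p', Kind.B) :=
      fun h2 => hne (target_B_injective (h2.symm.trans hp))
    simp [blockOp, h']
  · simp

lemma invB_mul_blockOp_B [NeZero l] [NeZero m] (hm : Even m) (w : Link l m → ℂ)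
    (hw : ∀ p, w (p, Kind.B) ≠ 0) : invB w * blockOp w Kind.B = 1 := by
  ext p p'
  rw [Matrix.mul_apply, Finset.sum_eq_single ⟨_, target_B_black hm p⟩]
  · by_cases h : p = p'
    · subst h
      simp [blockOp, invB, hw p]
    · have h' : ¬ Link.target (p, Kind.B) = Link.target (p', Kind.B) :=
        fun h2 => h (target_B_injective h2)
      simp [blockOp, h', h]
  · intro q _ hne
    have h' : ¬ q.1 = Link.target (p, Kind.B) := fun h2 => hne (Subtype.ext h2)
    simp [invB, h']
  · simp

/-- The determinant `det (1 + u A B⁻¹ - v D B⁻¹ - u v C B⁻¹)` on `H₂`. -/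
def determinant [NeZero l] [NeZero m] (w : Link l m → ℂ) (u v : ℂ) : ℂ :=
  Matrix.det (1 + u • (blockOp w Kind.A * invB w) - v • (blockOp w Kind.D * invB w)
    - (u * v) • (blockOp w Kind.C * invB w))

end Operators

/-! ### The dimer model -/

section Dimers

variable {l m : ℕ}

/-- A dimer configuration: a set of links such that every vertex is an end of exactly one of
them. -/
def IsDimerConfiguration (S : Finset (Link l m)) : Prop :=
  ∀ p : Vertex l m, ∃! e : Link l m, e ∈ S ∧ (p = e.source ∨ p = e.target)

/-- The weights of the dimer model: `ua`, `-b`, `-uvc`, `-vd`. -/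
def dimerWeight (w : Link l m → ℂ) (u v : ℂ) (e : Link l m) : ℂ :=
  match e.2 with
  | .A => u * w e
  | .B => - w e
  | .C => - (u * v * w e)
  | .D => - (v * w e)

open Classical in
/-- The statistical sum (partition function) of the dimer model. -/
def statisticalSum [NeZero l] [NeZero m] (w : Link l m → ℂ) (u v : ℂ) : ℂ :=
  ∑ S : Finset (Link l m) with IsDimerConfiguration S, ∏ e ∈ S, dimerWeight w u v e

/-- The statistical sum multiplied by the product of `-b⁻¹` over all `B`-links. -/
def normalizedSum [NeZero l] [NeZero m] (w : Link l m → ℂ) (u v : ℂ) : ℂ :=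
  (∏ p : White l m, -(w (p, Kind.B))⁻¹) * statisticalSum w u v

end Dimers

/-! ### Paths, homology classes and the monomials they yield -/

/-- Lattice paths on the torus; a link may be traversed from its white end to its black end
(`forward`) or the other way round (`backward`). -/
inductive LatticePath (l m : ℕ) (p : Vertex l m) : Vertex l m → Type
  | nil : LatticePath l m p p
  | forward (e : Link l m) (c : LatticePath l m p e.source) : LatticePath l m p e.target
  | backward (e : Link l m) (c : LatticePath l m p e.target) : LatticePath l m p e.source

/-- The displacement along the lift of a path to the plane. -/
def LatticePath.displacement {l m : ℕ} :
    {p q : Vertex l m} → LatticePath l m p q → ℤ × ℤ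
  | _, _, .nil => 0
  | _, _, .forward e c => c.displacement + e.2.step
  | _, _, .backward e c => c.displacement - e.2.step

/-- The exponents of `u` and `v` in the product of the link weights along a path, where a link
traversed from black to white contributes the inverse of its weight (so that a `B`-link
contributes `b⁻¹` when traversed downwards). -/
def LatticePath.degree {l m : ℕ} :
    {p q : Vertex l m} → LatticePath l m p q → ℤ × ℤ
  | _, _, .nil => 0
  | _, _, .forward e c => c.degree + e.2.degree
  | _, _, .backward e c => c.degree - e.2.degree

/-- A closed path on the torus. -/
structure Cycle (l m : ℕ) where
  base : Vertex l m
  path : LatticePath l m base base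

lemma LatticePath.end_eq {l m : ℕ} {p q : Vertex l m} (c : LatticePath l m p q) :
    q = (p.1 + (c.displacement.1 : ZMod l), p.2 + (c.displacement.2 : ZMod m)) := by
  induction c with
  | nil => simp only [LatticePath.displacement]; simp
  | forward e c ih =>
    simp only [LatticePath.displacement]
    generalize c.displacement = d at ih ⊢
    have h1 : e.1.1.1 = p.1 + d.1 := congrArg Prod.fst ih
    have h2 : e.1.1.2 = p.2 + d.2 := congrArg Prod.snd ih
    simp [Link.target, h1, h2, add_assoc]
  | backward e c ih =>
    simp only [LatticePath.displacement]
    generalize c.displacement = d at ih ⊢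
    have h1 : e.1.1.1 + e.2.step.1 = p.1 + d.1 := congrArg Prod.fst ih
    have h2 : e.1.1.2 + e.2.step.2 = p.2 + d.2 := congrArg Prod.snd ih
    ext
    · simp [Link.source, ← add_sub_assoc, ← h1]
    · simp [Link.source, ← add_sub_assoc, ← h2]

/-- The homology class of a closed path in `H₁` of the torus, which is `ℤ × ℤ`: the numbers of
times the path winds around the torus in the two directions. The divisions are exact, see
`Cycle.displacement_eq`. -/
def Cycle.homologyClass {l m : ℕ} (c : Cycle l m) : ℤ × ℤ :=
  (c.path.displacement.1 / l, c.path.displacement.2 / m)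

lemma Cycle.displacement_eq {l m : ℕ} (c : Cycle l m) :
    c.path.displacement = (l * c.homologyClass.1, m * c.homologyClass.2) := by
  have h := c.path.end_eq
  have h1 := congrArg Prod.fst h
  have h2 := congrArg Prod.snd h
  simp only [left_eq_add] at h1 h2
  rw [ZMod.intCast_zmod_eq_zero_iff_dvd] at h1 h2
  ext
  · exact (Int.mul_ediv_cancel' h1).symm
  · exact (Int.mul_ediv_cancel' h2).symm

/-- The intersection number of two closed paths on the torus. -/
def intersectionNumber {l m : ℕ} (α β : Cycle l m) : ℤ :=
  α.homologyClass.1 * β.homologyClass.2 - α.homologyClass.2 * β.homologyClass.1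

/-- Two closed paths are basis cycles if their intersection number is `1` for one of the two
orientations of the torus. -/
def IsCycleBasis {l m : ℕ} (α β : Cycle l m) : Prop :=
  |intersectionNumber α β| = 1

/-- The monomial in `u` and `v` that a closed path yields. -/
def Cycle.monomial {l m : ℕ} (c : Cycle l m) (u v : ℂ) : ℂ :=
  u ^ c.path.degree.1 * v ^ c.path.degree.2

/-! ### Laurent polynomials in two variables -/

/-- Laurent polynomials in two variables `x` and `y` over `ℂ`. -/
abbrev Laurent : Type := AddMonoidAlgebra ℂ (ℤ × ℤ)

/-- The value of a Laurent polynomial. -/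
def Laurent.eval (f : Laurent) (x y : ℂ) : ℂ :=
  f.coeff.sum fun n c => c * (x ^ n.1 * y ^ n.2)

/-- A Laurent polynomial is a polynomial if it has no negative exponents. -/
def Laurent.IsPolynomial (f : Laurent) : Prop :=
  ∀ n ∈ f.coeff.support, 0 ≤ n.1 ∧ 0 ≤ n.2

/-- `f(x, y)` is the function `g(u, v)` considered as a function of the monomials `x` and `y` that
are yielded by the closed paths `α` and `β`. -/
def Represents {l m : ℕ} (α β : Cycle l m) (f : Laurent) (g : ℂ → ℂ → ℂ) : Prop :=
  ∀ u v : ℂ, u ≠ 0 → v ≠ 0 → f.eval (α.monomial u v) (β.monomial u v) = g u v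

end DimerTorus

end

/-!
A dimer configuration assigns to each white vertex `p` the kind `k p` of its link, and moving the
black end of that link back along a `B`-link gives a permutation `σ` of the white vertices. Both
`determinant` and `normalizedSum` expand into sums over the same pairs `(σ, k)`
(`determinant_eq_sum`, `normalizedSum_eq_sum`), with equal terms up to sign: the sign is that of `σ`
in the former, and `-1` to the number of links which are not `B`-links (`dimerSign`) in the latter.

The links of a configuration, traversed forwards, and the `B`-links, traversed backwards, form
disjoint closed paths on the torus. They never ascend, and wind around the torus `n` times downwards
and `r` times horizontally, in total. The powers of `u` and `v` in the term of the configuration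
only depend on the homology class `(r, -n)`, and if its coordinates with respect to the cycles `α`
and `β` are `N`, the term is a multiple of `x ^ N.1 * y ^ N.2`. The signs in the two sums differ by
`-1` to the number of closed paths. This number is the greatest common divisor of `r` and `n`, so it
is even if and only if `N.1` and `N.2` both are. Averaging over the signs of `x` and `y` as in the
theorem changes the signs of exactly the terms where `N.1` and `N.2` are not both even
(`mul_zpow_eq_average`).

The number of closed paths is not computed; the sign of the permutation of the vertices of the paths
that moves each vertex one row down is found by counting inversions in the lexicographic order of the
vertices (`exists_winding_and_sign_eq`). In the universal cover, the paths keep their order from each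
row to the next. Hence two vertices of the same row are inverted if and only if one of their steps
crosses the seam of the fundamental domain and the other does not, and two vertices of different
rows are inverted if and only if one of them is in row `0`. Each of these conditions is a sum of
contributions of single vertices modulo `2`, and all rows contain `n` vertices, so that the sign is
`(-1) ^ (n + r * (n + 1))`.

Laurent polynomials in `x` and `y` are determined by their values as functions of `u` and `v`
because the characters of a group are linearly independent (`Represents.unique`). The cycles of the
classes `(-m, -1)` and `(1, 0)` lead to polynomials because the class `(r, -n)` has the coordinates
`n` and `r + m * n` (`nonneg_of_exponent_eq`).
-/

noncomputable section

namespace DimerTorus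

open Equiv Finset

/-! ### Signs of systems of disjoint closed paths -/

section PermutationSign

lemma prod_zpow_eq_zpow_sum {ι G : Type*} [CommGroup G] (s : Finset ι) (a : G) (c : ι → ℤ) :
    ∏ i ∈ s, a ^ c i = a ^ ∑ i ∈ s, c i :=
  (map_sum (zmultiplesHom (Additive G) (Additive.ofMul a)) c s).symm

variable {V : Type*} [Fintype V] [DecidableEq V]

lemma sign_eq_prod_of_injective {key : V → ℤ} (hkey : Function.Injective key) (σ : Perm V) :
    Perm.sign σ = ∏ j, ∏ i with key i < key j, if key (σ i) < key (σ j) then 1 else -1 := by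
  obtain ⟨e, he⟩ : ∃ e : V ≃ Fin (Fintype.card V), ∀ i j, e i < e j ↔ key i < key j := by
    let : LinearOrder V := LinearOrder.lift' key hkey
    let e : Fin (Fintype.card V) ≃o V := Fintype.orderIsoFinOfCardEq V rfl
    refine ⟨e.symm.toEquiv, fun i j => ?_⟩
    change e.symm i < e.symm j ↔ _
    rw [OrderIso.lt_iff_lt]
    rfl
  rw [← Perm.sign_permCongr e σ, Perm.sign_eq_prod_prod_Iio, ← Equiv.prod_comp e]
  refine Finset.prod_congr rfl fun j _ => ?_
  symm
  refine Finset.prod_equiv e (fun i => by simp [he]) fun i _ => ?_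
  simp [Equiv.permCongr_apply, he]

/-- If the factor of each pair in the inversion product splits symmetrically, then the sign is a
product over ordered pairs. -/
lemma sign_eq_prod_of_symm {key : V → ℤ} (hkey : Function.Injective key) (σ : Perm V)
    (g : V → V → ℤˣ)
    (hg : ∀ i j, key i < key j → (if key (σ i) < key (σ j) then 1 else -1) = g i j * g j i) :
    Perm.sign σ = ∏ i, ∏ j with j ≠ i, g i j := by
  have h1 : ∏ j, ∏ i with key i < key j, g i j = ∏ i, ∏ j with key i < key j, g i j :=
    Finset.prod_comm' (by simp)
  calc Perm.sign σ = ∏ j, ∏ i with key i < key j, g i j * g j i := by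
        rw [sign_eq_prod_of_injective hkey]
        exact Finset.prod_congr rfl fun j _ =>
          Finset.prod_congr rfl fun i hi => hg i j (by simpa using hi)
    _ = ∏ i, ((∏ j with key i < key j, g i j) * ∏ j with key j < key i, g i j) := by
        simp only [Finset.prod_mul_distrib]
        rw [h1]
    _ = _ := by
        refine Finset.prod_congr rfl fun i _ => ?_
        rw [← Finset.prod_union]
        · refine Finset.prod_congr ?_ fun _ _ => rfl
          ext j
          have : j ≠ i ↔ key j ≠ key i := hkey.ne_iff.symm
          simp only [Finset.mem_union, Finset.mem_filter, Finset.mem_univ, true_and, this]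
          omega
        · rw [Finset.disjoint_filter]
          intro j _ h
          omega

/-- The sign of a system of disjoint closed paths on a torus of size `l × m`. The points of `V`,
with coordinates `X` and `Y`, are moved by `Φ` to the next lower row, with a horizontal step `d` of
length at most one, which can be nonzero only at points of one colour. Then `Φ` winds around the
torus `n` times in the vertical and `r` times in the horizontal direction, in total, and its sign
depends only on these numbers. -/
theorem exists_winding_and_sign_eq {l m : ℕ} [NeZero l] [NeZero m] (hl : Even l) (hm : Even m)
    (Φ : Perm V) (X Y d : V → ℤ) (hX0 : ∀ v, 0 ≤ X v) (hXl : ∀ v, X v < l)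
    (hY0 : ∀ v, 0 ≤ Y v) (hYm : ∀ v, Y v < m)
    (hXY : ∀ v w, X v = X w → Y v = Y w → v = w)
    (hΦY : ∀ v, Y (Φ v) = Y v - 1 ∨ Y v = 0 ∧ Y (Φ v) = m - 1)
    (hΦX : ∀ v, (l : ℤ) ∣ X v + d v - X (Φ v))
    (hd : ∀ v, |d v| ≤ 1) (hdXY : ∀ v, d v ≠ 0 → (X v + Y v) % 2 = 1) :
    ∃ (n : ℕ) (r : ℤ), Fintype.card V = m * n ∧ ∑ v, d v = l * r ∧
      Perm.sign Φ = (-1) ^ n * ((-1) ^ r) ^ (n + 1) := by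
  have hl0 : (0 : ℤ) < l := by exact_mod_cast Nat.pos_of_ne_zero (NeZero.ne l)
  have hm0 : 0 < m := Nat.pos_of_ne_zero (NeZero.ne m)
  choose c hc using hΦX
  -- All rows contain the same number of points, since `Φ` maps every row bijectively to the next.
  let n : ℕ := #{v | Y v = 0}
  have hrow : ∀ y : ℕ, y < m → #{v | Y v = y} = n := by
    intro y
    induction y with
    | zero => intro _; simp [n]
    | succ y ih =>
      intro hy
      rw [← ih (by omega)]
      refine Finset.card_equiv Φ fun v => ?_
      have := hΦY v
      simp only [Finset.mem_filter, Finset.mem_univ, true_and]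
      push_cast
      omega
  have hrow' : ∀ v, #{w | Y w = Y v} = n := by
    intro v
    have h1 := hY0 v
    have h2 := hYm v
    obtain ⟨y, hy⟩ := Int.eq_ofNat_of_zero_le h1
    rw [hy]
    exact hrow y (by omega)
  have hcard : Fintype.card V = m * n := by
    have : ∀ v ∈ (Finset.univ : Finset V), (Y v).toNat ∈ Finset.range m := by
      intro v _
      have h1 := hY0 v
      have h2 := hYm v
      rw [Finset.mem_range]
      omega
    rw [← Finset.card_univ, Finset.card_eq_sum_card_fiberwise this,
      Finset.sum_congr rfl (g := fun _ => n), Finset.sum_const, Finset.card_range, smul_eq_mul]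
    intro y hy
    rw [← hrow y (Finset.mem_range.1 hy)]
    congr 1
    ext v
    have h1 := hY0 v
    simp only [Finset.mem_filter, Finset.mem_univ, true_and]
    omega
  refine ⟨n, ∑ v, c v, hcard, ?_, ?_⟩
  · have h := Finset.sum_congr rfl fun v (_ : v ∈ Finset.univ) => hc v
    rw [Finset.sum_sub_distrib, Finset.sum_add_distrib, Equiv.sum_comp Φ X,
      ← Finset.mul_sum] at h
    linarith
  have hkey : Function.Injective fun v => Y v * l + X v := by
    intro v w h
    have h' : Y v * l + X v = Y w * l + X w := h
    have hv := hXl v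
    have hw := hXl w
    have hv0 := hX0 v
    have hw0 := hX0 w
    have hY : Y v = Y w := by
      rcases lt_trichotomy (Y v) (Y w) with h1 | h1 | h1
      · nlinarith
      · exact h1
      · nlinarith
    exact hXY v w (by rw [hY] at h'; linarith) hY
  rw [sign_eq_prod_of_symm hkey Φ fun v w =>
    if Y w = Y v then (-1) ^ c v else if Y v = 0 then -1 else 1]
  · have hinner : ∀ v, ∏ w with w ≠ v,
        (if Y w = Y v then ((-1) ^ c v : ℤˣ) else if Y v = 0 then -1 else 1)
          = ((-1) ^ c v) ^ (n - 1) * (if Y v = 0 then -1 else 1) ^ (m * n - n) := by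
      intro v
      rw [Finset.prod_ite, Finset.prod_const, Finset.prod_const]
      have h1 : #{w ∈ ({w | w ≠ v} : Finset V) | Y w = Y v} = n - 1 := by
        rw [← hrow' v, ← Finset.card_erase_of_mem (a := v) (by simp)]
        congr 1
        ext w
        simp
      have h2 : #{w ∈ ({w | w ≠ v} : Finset V) | ¬ Y w = Y v} = m * n - n := by
        rw [← hcard, ← hrow' v, ← Finset.card_compl]
        congr 1
        ext w
        simp only [Finset.mem_filter, Finset.mem_univ, true_and, Finset.mem_compl]
        exact ⟨fun h => h.2, fun h => ⟨fun h' => h (by rw [h']), h⟩⟩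
      rw [h1, h2]
    rw [Finset.prod_congr rfl fun v _ => hinner v, Finset.prod_mul_distrib, Finset.prod_pow,
      Finset.prod_pow, Finset.prod_ite, Finset.prod_const, Finset.prod_const_one, mul_one]
    have hz : #{v | Y v = 0} = n := rfl
    rw [prod_zpow_eq_zpow_sum, hz, mul_comm]
    congr 1
    · rw [← pow_mul]
      -- `m` is even, so `n * (m - 1) * n` and `n` have the same parity.
      have hpar : Even (n * (m * n - n)) ↔ Even n := by
        rw [show m * n - n = (m - 1) * n by rw [Nat.sub_mul, one_mul], Nat.even_mul, Nat.even_mul]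
        have : ¬ Even (m - 1) := by
          rw [Nat.even_sub hm0]
          simp [hm]
        tauto
      rcases Nat.even_or_odd n with h | h
      · rw [h.neg_one_pow, (hpar.2 h).neg_one_pow]
      · rw [h.neg_one_pow, Odd.neg_one_pow]
        rw [← Nat.not_even_iff_odd] at h ⊢
        tauto
    · rcases Nat.eq_zero_or_pos n with h | h
      · -- Without points there is no winding.
        have : IsEmpty V := by
          rw [← Fintype.card_eq_zero_iff, hcard, h, mul_zero]
        simp
      · have : n + 1 = (n - 1) + 2 := by omega
        rw [this, pow_add, Int.units_sq, mul_one]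
  · intro v w hvw
    have hv0 := hX0 v
    have hv := hXl v
    have hw0 := hX0 w
    have hw := hXl w
    have hv0' := hX0 (Φ v)
    have hv' := hXl (Φ v)
    have hw0' := hX0 (Φ w)
    have hw' := hXl (Φ w)
    have hcv := hc v
    have hcw := hc w
    by_cases hY : Y v = Y w
    · have hYΦ : Y (Φ v) = Y (Φ w) := by
        have h1 := hΦY v
        have h2 := hΦY w
        have h3 := hY0 (Φ v)
        have h4 := hY0 (Φ w)
        omega
      have hXlt : X v < X w := by
        have hvw' : Y v * l + X v < Y w * l + X w := hvw
        rw [hY] at hvw'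
        linarith
      -- Two points of a row do not land at the same place modulo `l`.
      have hne : ∀ t : ℤ, X v + d v ≠ X w + d w + l * t := by
        intro t ht
        have hdvd : (l : ℤ) ∣ X (Φ v) - X (Φ w) := ⟨t + c w - c v, by linarith⟩
        have hX : X (Φ v) - X (Φ w) = 0 :=
          Int.eq_zero_of_abs_lt_dvd hdvd (by rw [abs_lt]; constructor <;> linarith)
        have := Φ.injective (hXY _ _ (by linarith) hYΦ)
        rw [this] at hXlt
        exact lt_irrefl _ hXlt
      -- Hence the lifts of the two paths to the universal cover do not cross.
      have hcross : X v + d v < X w + d w ∧ X w + d w < X v + d v + l := by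
        have h1 := hne 0
        have h2 := hne (-1)
        have h3 := hdXY v
        have h4 := hdXY w
        have h5 := abs_le.1 (hd v)
        have h6 := abs_le.1 (hd w)
        have h7 : (l : ℤ) % 2 = 0 := by
          have := Nat.even_iff.1 hl
          omega
        rw [mul_zero] at h1
        rw [mul_neg, mul_one] at h2
        omega
      have hc0 : 0 ≤ c w - c v := by
        by_contra hcon
        have : c w - c v ≤ -1 := by omega
        nlinarith
      have hc1 : c w - c v ≤ 1 := by
        by_contra hcon
        have : 2 ≤ c w - c v := by omega
        nlinarith
      simp only [hY, hYΦ, if_true, add_lt_add_iff_left]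
      obtain h | h : c w = c v ∨ c w = c v + 1 := by omega
      · rw [if_pos, h, Int.units_mul_self]
        rw [h] at hcw
        linarith
      · rw [if_neg, h, zpow_add, zpow_one, ← mul_assoc, Int.units_mul_self, one_mul]
        rw [h] at hcw
        push Not
        linarith
    · have hYlt : Y v < Y w := by
        have hvw' : Y v * l + X v < Y w * l + X w := hvw
        by_contra hcon
        have : Y w + 1 ≤ Y v := by omega
        nlinarith
      have h1 := hΦY v
      have h2 := hΦY w
      have h3 := hY0 v
      have h4 := hY0 w
      have h5 := hYm w
      rw [if_neg (Ne.symm hY), if_neg hY]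
      have hw1 : Y w ≠ 0 := by omega
      rw [if_neg hw1, mul_one]
      by_cases h0 : Y v = 0
      · rw [if_neg, if_pos h0]
        push Not
        have : Y (Φ w) + 1 ≤ Y (Φ v) := by
          have := hY0 (Φ v)
          omega
        nlinarith
      · rw [if_pos, if_neg h0]
        have : Y (Φ v) + 1 ≤ Y (Φ w) := by omega
        nlinarith

end PermutationSign

/-! ### The closed paths of a dimer configuration -/

section Configurations

variable {l m : ℕ}

/-- Dimer configurations are encoded by the kinds `k p` of the links at the white vertices `p`,
together with the permutation `σ` of the white vertices that arises if the black end of the link at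
`p` is moved back along the `B`-link which ends there. -/
def IsCompatible (σ : Perm (White l m)) (k : White l m → Kind) : Prop :=
  ∀ p, Link.target (σ p, Kind.B) = Link.target (p, k p)

lemma IsCompatible.apply_eq_self {σ : Perm (White l m)} {k : White l m → Kind}
    (h : IsCompatible σ k) {p : White l m} (hp : k p = Kind.B) : σ p = p :=
  target_B_injective (by rw [h p, hp])

lemma IsCompatible.eq_B_of_apply {σ : Perm (White l m)} {k : White l m → Kind}
    (h : IsCompatible σ k) {p : White l m} (hp : k (σ p) = Kind.B) : k p = Kind.B := by
  rwa [σ.injective (h.apply_eq_self hp)] at hp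

/-- All vertices of the torus, in terms of white vertices: `(p, false)` is the white vertex `p` and
`(p, true)` the black vertex above it. -/
def vertexOf (x : White l m × Bool) : Vertex l m :=
  if x.2 then Link.target (x.1, Kind.B) else x.1.1

lemma vertexOf_injective [NeZero m] (hm : Even m) :
    Function.Injective (vertexOf : White l m × Bool → Vertex l m) := by
  rintro ⟨p, b⟩ ⟨p', b'⟩ h
  cases b <;> cases b' <;> simp only [vertexOf, if_true, Bool.false_eq_true, if_false] at h
  · rw [Subtype.ext h]
  · exact absurd (h ▸ p.2) (target_B_black hm p')
  · exact absurd (h ▸ p'.2) (target_B_black hm p)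
  · rw [target_B_injective h]

/-- The closed paths of a configuration consist of its links, traversed forwards, and of `B`-links,
traversed backwards. This permutation moves each vertex which a path leaves downwards to the next
such vertex, which lies one row below, and fixes the others. The move of a black vertex by two rows
through a `C`-link is thus broken up into two, at the white vertex in between. -/
def descent (σ : Perm (White l m)) (k : White l m → Kind) :
    Perm (White l m × Bool) :=
  prodCongrLeft (fun b => if b then σ else 1) *
    prodCongrRight fun p => if k p = Kind.C then swap false true else 1

/-- The vertices from which the paths descend vertically. -/
def Descends (k : White l m → Kind) (x : White l m × Bool) : Prop :=
  if x.2 then k x.1 ≠ Kind.B else k x.1 = Kind.C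

instance (k : White l m → Kind) : DecidablePred (Descends k) := fun x => by
  unfold Descends; infer_instance

section

variable {σ : Perm (White l m)} {k : White l m → Kind}

lemma descent_apply (σ : Perm (White l m)) (k : White l m → Kind) (p : White l m) (b : Bool) :
    descent σ k (p, b) =
      if k p = Kind.C then (if b then (p, false) else (σ p, true))
      else (if b then (σ p, true) else (p, false)) := by
  by_cases h : k p = Kind.C <;> cases b <;> simp [descent, h]

lemma descends_descent_iff (h : IsCompatible σ k) (x : White l m × Bool) :
    Descends k (descent σ k x) ↔ Descends k x := by
  obtain ⟨p, b⟩ := x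
  have h1 := fun hp : k p = Kind.B => h.apply_eq_self hp
  have h2 := fun hp : k (σ p) = Kind.B => h.eq_B_of_apply hp
  rw [descent_apply]
  by_cases hC : k p = Kind.C
  · cases b
    · simp only [Descends, hC, if_true, Bool.false_eq_true, if_false, iff_true]
      intro h3
      simpa [hC] using h2 h3
    · simp [Descends, hC]
  · cases b
    · simp [Descends, hC]
    · simp only [Descends, hC, if_true, if_false]
      refine not_congr ⟨h2, fun h3 => ?_⟩
      rwa [h1 h3]

lemma descends_of_descent_ne (h : IsCompatible σ k) (x : White l m × Bool)
    (hx : descent σ k x ≠ x) : Descends k x := by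
  obtain ⟨p, b⟩ := x
  rw [descent_apply] at hx
  by_contra hcon
  cases b
  · have hC : k p ≠ Kind.C := by simpa [Descends] using hcon
    simp [hC] at hx
  · have hB : k p = Kind.B := by simpa [Descends] using hcon
    simp [hB, h.apply_eq_self hB] at hx

lemma sign_descent [NeZero l] [NeZero m] (σ : Perm (White l m)) (k : White l m → Kind) :
    Perm.sign (descent σ k) = Perm.sign σ * ∏ p, if k p = Kind.C then -1 else 1 := by
  rw [descent, map_mul, Perm.sign_prodCongrLeft, Perm.sign_prodCongrRight]
  congr 1
  · simp
  · refine Finset.prod_congr rfl fun p _ => ?_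
    split_ifs
    · exact Perm.sign_swap (by decide)
    · exact Perm.sign_one

/-- The horizontal step that `descent` makes from a vertex. -/
def horizontalStep (k : White l m → Kind) (x : White l m × Bool) : ℤ :=
  if x.2 then (k x.1).step.1 else 0

lemma vertexOf_descent (h : IsCompatible σ k) {x : White l m × Bool} (hx : Descends k x) :
    vertexOf (descent σ k x)
      = ((vertexOf x).1 + (horizontalStep k x : ZMod l), (vertexOf x).2 - 1) := by
  obtain ⟨p, b⟩ := x
  have hp := h p
  rw [descent_apply]
  cases b
  · have hC : k p = Kind.C := by simpa [Descends] using hx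
    simp only [hC, vertexOf, horizontalStep, if_true, Bool.false_eq_true, if_false]
    rw [hp, hC]
    simp [Link.target, Kind.step, sub_eq_add_neg]
  · have hB : k p ≠ Kind.B := by simpa [Descends] using hx
    by_cases hC : k p = Kind.C
    · simp [hC, vertexOf, horizontalStep, target_B, Kind.step]
    · simp only [hC, vertexOf, horizontalStep, if_true, if_false]
      rw [hp, target_B]
      cases hk : k p
      · simp [Link.target, Kind.step]
      · exact absurd hk hB
      · exact absurd hk hC
      · simp [Link.target, Kind.step]

/-- The winding numbers `-n` and `r` of the closed paths formed by a dimer configuration and the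
`B`-links determine the exponents of `u` and `v` in its weight and, modulo `2`, the sign of the
permutation. -/
theorem IsCompatible.exists_winding [NeZero l] [NeZero m] (hl : Even l) (hm : Even m)
    (h : IsCompatible σ k) :
    ∃ (n : ℕ) (r : ℤ),
      ∑ p, (k p).degree.1 + ∑ p, (k p).degree.2 = m * n ∧
      ∑ p, (k p).degree.1 - ∑ p, (k p).degree.2 = l * r ∧
      Perm.sign σ * ∏ p, (if k p = Kind.B then 1 else -1) = (-1) ^ n * ((-1) ^ r) ^ (n + 1) := by
  obtain ⟨n, r, hn, hr, hs⟩ := exists_winding_and_sign_eq hl hm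
    ((descent σ k).subtypePerm (p := Descends k) (descends_descent_iff h))
    (fun x => (vertexOf x.1).1.val) (fun x => (vertexOf x.1).2.val)
    (fun x => horizontalStep k x.1)
    (fun x => by positivity) (fun x => by exact_mod_cast ZMod.val_lt _)
    (fun x => by positivity) (fun x => by exact_mod_cast ZMod.val_lt _)
    (fun x y h1 h2 => by
      refine Subtype.ext (vertexOf_injective hm (Prod.ext ?_ ?_))
      · exact ZMod.val_injective l (by exact_mod_cast h1)
      · exact ZMod.val_injective m (by exact_mod_cast h2))
    (fun x => by
      rw [Perm.subtypePerm_apply]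
      have h1 := congrArg Prod.snd (vertexOf_descent h x.2)
      have h2 : (m : ℤ) ∣ (vertexOf x.1).2.val - 1 - (vertexOf (descent σ k x.1)).2.val := by
        rw [← ZMod.intCast_zmod_eq_zero_iff_dvd]
        simp [h1]
      have h3 := ZMod.val_lt (vertexOf x.1).2
      have h4 := ZMod.val_lt (vertexOf (descent σ k x.1)).2
      obtain ⟨t, ht⟩ := h2
      have ht0 : t ≤ 0 := by
        by_contra hcon
        nlinarith
      have ht1 : -1 ≤ t := by
        by_contra hcon
        nlinarith
      obtain rfl | rfl : t = 0 ∨ t = -1 := by omega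
      · left
        linarith
      · right
        change ((vertexOf x.1).2.val : ℤ) = 0 ∧
          ((vertexOf (descent σ k x.1)).2.val : ℤ) = m - 1
        omega)
    (fun x => by
      rw [Perm.subtypePerm_apply]
      have h1 := congrArg Prod.fst (vertexOf_descent h x.2)
      rw [← ZMod.intCast_zmod_eq_zero_iff_dvd]
      simp [h1])
    (fun x => by
      unfold horizontalStep
      split_ifs
      · cases k x.1.1 <;> simp [Kind.step]
      · simp)
    (fun x hx => by
      obtain ⟨⟨p, b⟩, hp⟩ := x
      cases b
      · simp [horizontalStep] at hx
      · have := target_B_black hm p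
        rw [IsWhite, Nat.not_even_iff] at this
        exact_mod_cast this)
  have hcard : ∑ p, (k p).degree.1 + ∑ p, (k p).degree.2 = m * n := by
    have h1 : (Fintype.card {x // Descends k x} : ℤ) = m * n := by exact_mod_cast hn
    rw [← h1, Fintype.card_subtype, Finset.card_filter, Fintype.sum_prod_type,
      ← Finset.sum_add_distrib]
    push_cast
    refine Finset.sum_congr rfl fun p _ => ?_
    cases hk : k p <;> simp [Descends, hk, Kind.degree]
  refine ⟨n, r, hcard, ?_, ?_⟩
  · rw [← hr, ← Finset.sum_subtype ({x | Descends k x} : Finset _) (by simp) (horizontalStep k),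
      Finset.sum_filter, Fintype.sum_prod_type, ← Finset.sum_sub_distrib]
    refine Finset.sum_congr rfl fun p _ => ?_
    cases hk : k p <;> simp [Descends, horizontalStep, hk, Kind.degree, Kind.step]
  · rw [Perm.sign_subtypePerm _ _ (descends_of_descent_ne h), sign_descent] at hs
    rw [← hs]
    congr 1
    -- The paths have `m * n` vertices from which they descend, an even number.
    have h1 : (∏ p, if k p = Kind.C then (-1 : ℤˣ) else 1)
        * ∏ p, (if k p = Kind.B then (1 : ℤˣ) else -1) = 1 := by
      rw [← Finset.prod_mul_distrib]
      calc _ = ∏ p, (-1 : ℤˣ) ^ ((k p).degree.1 + (k p).degree.2) := by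
            refine Finset.prod_congr rfl fun p _ => ?_
            cases k p <;> simp [Kind.degree]
        _ = 1 := by
            rw [prod_zpow_eq_zpow_sum, Finset.sum_add_distrib, hcard]
            exact Even.neg_one_zpow ((Int.even_coe_nat m |>.2 hm).mul_right _)
    rw [mul_eq_one_iff_eq_inv] at h1
    rw [h1, Int.units_inv_eq_self]

end

end Configurations

/-! ### Expansions over dimer configurations -/

section Expansions

variable {l m : ℕ} [NeZero l] [NeZero m]

lemma isWhite_add_one_left {l m : ℕ} [NeZero l] (hl : Even l) (x : ZMod l) (y : ZMod m) :
    IsWhite (x + 1, y) ↔ ¬ IsWhite (x, y) := by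
  simp only [IsWhite, Nat.even_add, even_val_iff hl]
  tauto

lemma target_not_isWhite (hl : Even l) (hm : Even m) (e : Link l m) : ¬ IsWhite e.target := by
  obtain ⟨⟨⟨x, y⟩, hp⟩, κ⟩ := e
  cases κ
  · simpa [Link.target, Kind.step, isWhite_add_one_left hl] using hp
  · simpa [Link.target, Kind.step, isWhite_add_one hm] using hp
  · have := isWhite_add_one hm x (y - 1)
    rw [sub_add_cancel] at this
    simpa [Link.target, Kind.step, ← sub_eq_add_neg] using this.1 hp
  · have := isWhite_add_one_left hl (x - 1) y
    rw [sub_add_cancel] at this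
    simpa [Link.target, Kind.step, ← sub_eq_add_neg] using this.1 hp

/-- The bijection between white and black vertices given by the `B`-links. -/
def whiteEquivBlack (hm : Even m) : White l m ≃ Black l m :=
  Equiv.ofBijective (fun p => ⟨Link.target (p, Kind.B), target_B_black hm p⟩)
    ⟨fun _ _ h => target_B_injective (congrArg Subtype.val h), fun q => by
      obtain ⟨p, hp⟩ := target_B_surjective hm q
      exact ⟨p, Subtype.ext hp.symm⟩⟩

lemma coe_whiteEquivBlack {l m : ℕ} [NeZero m] (hm : Even m) (p : White l m) :
    (whiteEquivBlack hm p).1 = Link.target (p, Kind.B) :=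
  rfl

/-- The factor, up to powers of `u` and `v`, that the link of kind `κ` at `p` contributes to the
determinant. -/
def linkFactor (w : Link l m → ℂ) (p : White l m) : Kind → ℂ
  | .A => w (p, Kind.A) * (w (p, Kind.B))⁻¹
  | .B => 1
  | .C => -(w (p, Kind.C) * (w (p, Kind.B))⁻¹)
  | .D => -(w (p, Kind.D) * (w (p, Kind.B))⁻¹)

open Classical in
/-- The pairs `(σ, k)` that encode dimer configurations. -/
def configurations (l m : ℕ) [NeZero l] [NeZero m] :
    Finset (Perm (White l m) × (White l m → Kind)) :=
  {x | IsCompatible x.1 x.2}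

lemma mem_configurations {x : Perm (White l m) × (White l m → Kind)} :
    x ∈ configurations l m ↔ IsCompatible x.1 x.2 := by
  simp [configurations]

lemma blockOp_mul_invB_apply (hm : Even m) (w : Link l m → ℂ) (κ : Kind) (q : Black l m)
    (p : White l m) :
    (blockOp w κ * invB w) q (whiteEquivBlack hm p)
      = if q.1 = Link.target (p, κ) then w (p, κ) * (w (p, Kind.B))⁻¹ else 0 := by
  rw [Matrix.mul_apply, Finset.sum_eq_single p]
  · simp [blockOp, invB, coe_whiteEquivBlack]
  · intro p' _ hne
    have : ¬ Link.target (p, Kind.B) = Link.target (p', Kind.B) :=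
      fun h => hne (target_B_injective h).symm
    simp [invB, coe_whiteEquivBlack, this]
  · simp

lemma determinant_eq_sum (hm : Even m) (w : Link l m → ℂ) (u v : ℂ) :
    determinant w u v = ∑ x ∈ configurations l m, ((Perm.sign x.1 : ℤ) : ℂ) *
      ∏ p, linkFactor w p (x.2 p) * (u ^ (x.2 p).degree.1 * v ^ (x.2 p).degree.2) := by
  classical
  rw [determinant, ← Matrix.det_submatrix_equiv_self (whiteEquivBlack hm), Matrix.det_apply',
    configurations, Finset.sum_filter, Fintype.sum_prod_type]
  refine Finset.sum_congr rfl fun σ _ => ?_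
  have hentry : ∀ p' p : White l m,
      (1 + u • (blockOp w Kind.A * invB w) - v • (blockOp w Kind.D * invB w)
        - (u * v) • (blockOp w Kind.C * invB w)).submatrix
          (whiteEquivBlack hm) (whiteEquivBlack hm) p' p
      = ∑ κ, if Link.target (p', Kind.B) = Link.target (p, κ) then
          linkFactor w p κ * (u ^ κ.degree.1 * v ^ κ.degree.2) else 0 := by
    intro p' p
    have hone : (1 : Matrix (Black l m) (Black l m) ℂ) (whiteEquivBlack hm p')
        (whiteEquivBlack hm p)
        = if Link.target (p', Kind.B) = Link.target (p, Kind.B) then 1 else 0 := by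
      rw [Matrix.one_apply]
      refine if_congr ?_ rfl rfl
      rw [(whiteEquivBlack hm).injective.eq_iff]
      exact ⟨fun h => by rw [h], fun h => target_B_injective h⟩
    have huniv : (Finset.univ : Finset Kind) = {.A, .B, .C, .D} := rfl
    rw [Matrix.submatrix_apply, Matrix.sub_apply, Matrix.sub_apply, Matrix.add_apply,
      Matrix.smul_apply, Matrix.smul_apply, Matrix.smul_apply, blockOp_mul_invB_apply,
      blockOp_mul_invB_apply, blockOp_mul_invB_apply, hone, coe_whiteEquivBlack, huniv]
    simp only [smul_eq_mul, linkFactor, Kind.degree]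
    rw [Finset.sum_insert (by decide), Finset.sum_insert (by decide),
      Finset.sum_insert (by decide), Finset.sum_singleton]
    simp only [zpow_one, zpow_zero, mul_ite, mul_zero, mul_one, one_mul]
    split_ifs <;> ring
  simp only [hentry]
  rw [Finset.prod_univ_sum, Fintype.piFinset_univ, Finset.mul_sum]
  refine Finset.sum_congr rfl fun k _ => ?_
  rw [Finset.prod_ite_zero]
  simp only [Finset.mem_univ, true_imp_iff, mul_ite, mul_zero]
  exact if_congr Iff.rfl rfl rfl

/-- The set of links of the configuration that is encoded by `k`. -/
def linkSet (k : White l m → Kind) : Finset (Link l m) :=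
  Finset.univ.map ⟨fun p => (p, k p), fun _ _ h => congrArg Prod.fst h⟩

lemma mem_linkSet {k : White l m → Kind} {e : Link l m} : e ∈ linkSet k ↔ e.2 = k e.1 := by
  obtain ⟨p, κ⟩ := e
  simp only [linkSet, Finset.mem_map, Finset.mem_univ, true_and]
  constructor
  · rintro ⟨_, h⟩
    obtain ⟨rfl, rfl⟩ := Prod.mk.inj h
    rfl
  · intro h
    exact ⟨p, Prod.ext rfl h.symm⟩

lemma IsCompatible.isDimerConfiguration (hl : Even l) (hm : Even m) {σ : Perm (White l m)}
    {k : White l m → Kind} (h : IsCompatible σ k) : IsDimerConfiguration (linkSet k) := by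
  intro v
  by_cases hv : IsWhite v
  · refine ⟨(⟨v, hv⟩, k ⟨v, hv⟩), ⟨mem_linkSet.2 rfl, Or.inl rfl⟩, ?_⟩
    rintro ⟨p, κ⟩ ⟨he, hsource | htarget⟩
    · obtain rfl : κ = k p := mem_linkSet.1 he
      obtain rfl : p = ⟨v, hv⟩ := Subtype.ext hsource.symm
      rfl
    · exact absurd hv (htarget ▸ target_not_isWhite hl hm _)
  · obtain ⟨q, hq⟩ := target_B_surjective hm ⟨v, hv⟩
    have hσ : ∀ p, Link.target (p, k p) = v ↔ σ p = q := by
      intro p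
      rw [← h p, show v = _ from hq]
      exact ⟨fun h => target_B_injective h, fun h => by rw [h]⟩
    refine ⟨(σ.symm q, k (σ.symm q)), ⟨mem_linkSet.2 rfl, Or.inr ?_⟩, ?_⟩
    · rw [eq_comm, hσ, Equiv.apply_symm_apply]
    · rintro ⟨p, κ⟩ ⟨he, hsource | htarget⟩
      · exact absurd (hsource ▸ p.2) hv
      · obtain rfl : κ = k p := mem_linkSet.1 he
        obtain rfl : p = σ.symm q := by rw [Equiv.eq_symm_apply, ← hσ, ← htarget]
        rfl

lemma IsDimerConfiguration.exists_isCompatible (hl : Even l) (hm : Even m)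
    {S : Finset (Link l m)} (h : IsDimerConfiguration S) :
    ∃ (σ : Perm (White l m)) (k : White l m → Kind), IsCompatible σ k ∧ linkSet k = S := by
  have hk : ∀ p : White l m, ∃ κ : Kind, (p, κ) ∈ S := by
    intro p
    obtain ⟨⟨p', κ⟩, ⟨he, hsource | htarget⟩, -⟩ := h p.1
    · obtain rfl : p = p' := Subtype.ext hsource
      exact ⟨κ, he⟩
    · exact absurd p.2 (htarget ▸ target_not_isWhite hl hm _)
  choose k hk using hk
  have hσ : ∀ p : White l m, ∃ q : White l m,
      Link.target (q, Kind.B) = Link.target (p, k p) := by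
    intro p
    obtain ⟨q, hq⟩ := target_B_surjective hm ⟨_, target_not_isWhite hl hm (p, k p)⟩
    exact ⟨q, hq.symm⟩
  choose σ hσ using hσ
  have hinj : Function.Injective σ := by
    intro p p' hpp'
    have h1 := (h (Link.target (p, k p))).unique ⟨hk p, Or.inr rfl⟩
      ⟨hk p', Or.inr (by rw [← hσ p, ← hσ p', hpp'])⟩
    exact congrArg Prod.fst h1
  refine ⟨Equiv.ofBijective σ (Finite.injective_iff_bijective.1 hinj), k, hσ, ?_⟩
  ext ⟨p, κ⟩
  rw [mem_linkSet]
  constructor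
  · intro h
    exact (show κ = k p from h) ▸ hk p
  · intro he
    exact congrArg Prod.snd ((h p.1).unique ⟨he, Or.inl rfl⟩ ⟨hk p, Or.inl rfl⟩)

lemma statisticalSum_eq_sum (hl : Even l) (hm : Even m) (w : Link l m → ℂ) (u v : ℂ) :
    statisticalSum w u v
      = ∑ x ∈ configurations l m, ∏ p, dimerWeight w u v (p, x.2 p) := by
  classical
  symm
  refine Finset.sum_bij (fun x _ => linkSet x.2) ?_ ?_ ?_ ?_
  · intro x hx
    rw [Finset.mem_filter]
    exact ⟨Finset.mem_univ _, (mem_configurations.1 hx).isDimerConfiguration hl hm⟩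
  · rintro ⟨σ, k⟩ hx ⟨σ', k'⟩ hx' (h : linkSet k = linkSet k')
    obtain rfl : k = k' := by
      ext1 p
      have : (p, k p) ∈ linkSet k := mem_linkSet.2 rfl
      rw [h] at this
      exact mem_linkSet.1 this
    obtain rfl : σ = σ' := by
      ext1 p
      exact target_B_injective (((mem_configurations.1 hx) p).trans
        ((mem_configurations.1 hx') p).symm)
    rfl
  · intro S hS
    obtain ⟨σ, k, h, hkS⟩ := ((Finset.mem_filter.1 hS).2).exists_isCompatible hl hm
    exact ⟨(σ, k), mem_configurations.2 h, hkS⟩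
  · intro x _
    rw [linkSet, Finset.prod_map]
    rfl

lemma normalizedSum_eq_sum (hl : Even l) (hm : Even m) (w : Link l m → ℂ)
    (hw : ∀ p, w (p, Kind.B) ≠ 0) (u v : ℂ) :
    normalizedSum w u v = ∑ x ∈ configurations l m,
      (((∏ p, if x.2 p = Kind.B then 1 else -1 : ℤˣ) : ℤ) : ℂ) *
        ∏ p, linkFactor w p (x.2 p) * (u ^ (x.2 p).degree.1 * v ^ (x.2 p).degree.2) := by
  rw [normalizedSum, statisticalSum_eq_sum hl hm, Finset.mul_sum]
  refine Finset.sum_congr rfl fun x _ => ?_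
  rw [Units.coe_prod, Int.cast_prod, ← Finset.prod_mul_distrib, ← Finset.prod_mul_distrib]
  refine Finset.prod_congr rfl fun p _ => ?_
  cases x.2 p
  · simp [dimerWeight, linkFactor, Kind.degree]; ring
  · simp [dimerWeight, linkFactor, Kind.degree, hw p]
  · simp [dimerWeight, linkFactor, Kind.degree]; ring
  · simp [dimerWeight, linkFactor, Kind.degree]; ring

end Expansions

/-! ### Closed paths, their monomials and Laurent polynomials -/

section Cycles

variable {l m : ℕ} [NeZero l] [NeZero m]

/-- The exponents of `u` and `v` along a path are determined by its displacement and the colours of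
its ends. -/
lemma LatticePath.two_mul_degree (hl : Even l) (hm : Even m) {p q : Vertex l m}
    (c : LatticePath l m p q) :
    2 * c.degree.1 = c.displacement.1 - c.displacement.2
        + (if IsWhite q then 0 else 1) - (if IsWhite p then 0 else 1) ∧
      2 * c.degree.2 = -c.displacement.1 - c.displacement.2
        + (if IsWhite q then 0 else 1) - (if IsWhite p then 0 else 1) := by
  have hlink : ∀ e : Link l m, 2 * e.2.degree.1 = e.2.step.1 - e.2.step.2 + 1 ∧
      2 * e.2.degree.2 = -e.2.step.1 - e.2.step.2 + 1 := by
    rintro ⟨p, κ⟩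
    cases κ <;> simp [Kind.degree, Kind.step]
  induction c with
  | nil => simp [LatticePath.degree, LatticePath.displacement]
  | forward e c ih =>
    have he := hlink e
    rw [if_pos (show IsWhite e.source from e.1.2)] at ih
    rw [if_neg (target_not_isWhite hl hm e)]
    simp only [LatticePath.degree, LatticePath.displacement, Prod.fst_add, Prod.snd_add]
    constructor <;> linarith [ih.1, ih.2, he.1, he.2]
  | backward e c ih =>
    have he := hlink e
    rw [if_neg (target_not_isWhite hl hm e)] at ih
    rw [if_pos (show IsWhite e.source from e.1.2)]
    simp only [LatticePath.degree, LatticePath.displacement, Prod.fst_sub, Prod.snd_sub]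
    constructor <;> linarith [ih.1, ih.2, he.1, he.2]

lemma Cycle.two_mul_degree (hl : Even l) (hm : Even m) (c : Cycle l m) :
    2 * c.path.degree.1 = l * c.homologyClass.1 - m * c.homologyClass.2 ∧
      2 * c.path.degree.2 = -(l * c.homologyClass.1) - m * c.homologyClass.2 := by
  have h := c.path.two_mul_degree hl hm
  rw [c.displacement_eq] at h
  simpa using h

lemma exists_target_eq (hl : Even l) (hm : Even m) {q : Vertex l m} (hq : ¬ IsWhite q)
    (κ : Kind) : ∃ e : Link l m, e.2 = κ ∧ e.target = q := by
  obtain ⟨x, y⟩ := q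
  have hx := isWhite_add_one_left hl (x - 1) y
  have hx' := isWhite_add_one_left hl x y
  have hy := isWhite_add_one hm x (y - 1)
  have hy' := isWhite_add_one hm x y
  rw [sub_add_cancel] at hx hy
  have hwhite : IsWhite ((x - (κ.step.1 : ZMod l), y - (κ.step.2 : ZMod m)) : Vertex l m) := by
    cases κ <;> simp only [Kind.step, Int.cast_one, Int.cast_zero, Int.cast_neg, sub_zero,
      sub_neg_eq_add] <;> tauto
  exact ⟨(⟨_, hwhite⟩, κ), rfl, by simp [Link.target]⟩

lemma LatticePath.exists_extend (hl : Even l) (hm : Even m) {p q : Vertex l m}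
    (c : LatticePath l m p q) (κ : Kind) :
    ∃ (q' : Vertex l m) (c' : LatticePath l m p q'),
      c'.displacement = c.displacement + κ.step := by
  by_cases hq : IsWhite q
  · obtain ⟨e, rfl, rfl⟩ : ∃ e : Link l m, e.2 = κ ∧ e.source = q := ⟨(⟨q, hq⟩, κ), rfl, rfl⟩
    exact ⟨_, LatticePath.forward e c, by rw [LatticePath.displacement]⟩
  · obtain ⟨κ', hκ'⟩ : ∃ κ' : Kind, κ.step = -κ'.step := by
      cases κ
      exacts [⟨.D, rfl⟩, ⟨.C, rfl⟩, ⟨.B, rfl⟩, ⟨.A, rfl⟩]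
    obtain ⟨e, rfl, rfl⟩ := exists_target_eq hl hm hq κ'
    exact ⟨_, LatticePath.backward e c, by rw [hκ', LatticePath.displacement, sub_eq_add_neg]⟩

lemma LatticePath.exists_displacement_eq (hl : Even l) (hm : Even m) (p : Vertex l m) (a b : ℤ) :
    ∃ (q : Vertex l m) (c : LatticePath l m p q), c.displacement = (a, b) := by
  have hstep : ∀ (κ : Kind) (d : ℤ × ℤ),
      (∃ (q : Vertex l m) (c : LatticePath l m p q), c.displacement = d) →
      ∃ (q : Vertex l m) (c : LatticePath l m p q), c.displacement = d + κ.step := by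
    rintro κ d ⟨q, c, rfl⟩
    exact c.exists_extend hl hm κ
  have hfst : ∃ (q : Vertex l m) (c : LatticePath l m p q), c.displacement = (a, 0) := by
    induction a using Int.induction_on with
    | zero => exact ⟨p, .nil, by rw [LatticePath.displacement]; rfl⟩
    | succ i ih => simpa [Kind.step] using hstep .A _ ih
    | pred i ih => simpa [Kind.step, sub_eq_add_neg] using hstep .D _ ih
  induction b using Int.induction_on with
  | zero => exact hfst
  | succ i ih => simpa [Kind.step] using hstep .B _ ih
  | pred i ih => simpa [Kind.step, sub_eq_add_neg] using hstep .C _ ih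

lemma Cycle.exists_homologyClass_eq (hl : Even l) (hm : Even m) (a b : ℤ) :
    ∃ c : Cycle l m, c.homologyClass = (a, b) := by
  obtain ⟨q, c, hc⟩ := LatticePath.exists_displacement_eq hl hm (0 : Vertex l m) (l * a) (m * b)
  obtain rfl : q = 0 := by
    have h := c.end_eq
    rw [hc] at h
    rw [h]
    simp
  refine ⟨⟨0, c⟩, ?_⟩
  have hl0 : (l : ℤ) ≠ 0 := by exact_mod_cast NeZero.ne l
  have hm0 : (m : ℤ) ≠ 0 := by exact_mod_cast NeZero.ne m
  rw [Cycle.homologyClass, hc, Int.mul_ediv_cancel_left _ hl0, Int.mul_ediv_cancel_left _ hm0]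

/-- The exponents of `u` and `v` in the product of the powers with exponents `N.1` and `N.2` of the
monomials that two closed paths yield. -/
def exponent (α β : Cycle l m) (N : ℤ × ℤ) : ℤ × ℤ :=
  (α.path.degree.1 * N.1 + β.path.degree.1 * N.2, α.path.degree.2 * N.1 + β.path.degree.2 * N.2)

omit [NeZero l] [NeZero m] in
lemma monomial_zpow_mul_monomial_zpow (α β : Cycle l m) (N : ℤ × ℤ) {u v : ℂ} (hu : u ≠ 0)
    (hv : v ≠ 0) :
    α.monomial u v ^ N.1 * β.monomial u v ^ N.2
      = u ^ (exponent α β N).1 * v ^ (exponent α β N).2 := by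
  simp only [Cycle.monomial, exponent, mul_zpow, ← zpow_mul, zpow_add₀ hu, zpow_add₀ hv]
  ring

/-- Twice the exponent in terms of the homology class of the linear combination of the two closed
paths. -/
lemma two_mul_exponent (hl : Even l) (hm : Even m) (α β : Cycle l m) (N : ℤ × ℤ) :
    2 * (exponent α β N).1
        = l * (α.homologyClass.1 * N.1 + β.homologyClass.1 * N.2)
          - m * (α.homologyClass.2 * N.1 + β.homologyClass.2 * N.2) ∧
      2 * (exponent α β N).2
        = -(l * (α.homologyClass.1 * N.1 + β.homologyClass.1 * N.2))
          - m * (α.homologyClass.2 * N.1 + β.homologyClass.2 * N.2) := by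
  have hα := α.two_mul_degree hl hm
  have hβ := β.two_mul_degree hl hm
  simp only [exponent]
  constructor
  · linear_combination N.1 * hα.1 + N.2 * hβ.1
  · linear_combination N.1 * hα.2 + N.2 * hβ.2

lemma exponent_injective (hl : Even l) (hm : Even m) {α β : Cycle l m}
    (h : IsCycleBasis α β) : Function.Injective (exponent α β) := by
  intro N N' hN
  have hl0 : (l : ℤ) ≠ 0 := by exact_mod_cast NeZero.ne l
  have hm0 : (m : ℤ) ≠ 0 := by exact_mod_cast NeZero.ne m
  have h1 := two_mul_exponent hl hm α β N
  have h2 := two_mul_exponent hl hm α β N'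
  rw [hN] at h1
  have hx : α.homologyClass.1 * N.1 + β.homologyClass.1 * N.2
      = α.homologyClass.1 * N'.1 + β.homologyClass.1 * N'.2 :=
    mul_left_cancel₀ hl0 (by linarith [h1.1, h1.2, h2.1, h2.2])
  have hy : α.homologyClass.2 * N.1 + β.homologyClass.2 * N.2
      = α.homologyClass.2 * N'.1 + β.homologyClass.2 * N'.2 :=
    mul_left_cancel₀ hm0 (by linarith [h1.1, h1.2, h2.1, h2.2])
  have hdet : intersectionNumber α β ≠ 0 := by
    intro h0
    rw [IsCycleBasis, h0] at h
    simp at h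
  rw [intersectionNumber] at hdet
  refine Prod.ext (mul_left_cancel₀ hdet ?_) (mul_left_cancel₀ hdet ?_)
  · linear_combination β.homologyClass.2 * hx - β.homologyClass.1 * hy
  · linear_combination α.homologyClass.1 * hy - α.homologyClass.2 * hx

lemma zpow_left_two_injective : Function.Injective fun n : ℤ => (2 : ℂ) ^ n := by
  intro a b h
  have h' : ((2 : ℝ) ^ a : ℂ) = ((2 : ℝ) ^ b : ℂ) := by simpa using h
  exact zpow_right_injective₀ (by norm_num : (0 : ℝ) < 2) (by norm_num) (by exact_mod_cast h')

/-- The characters `(u, v) ↦ u ^ a * v ^ b` are linearly independent, and different exponents of `x`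
and `y` yield different characters, so that a function of `u` and `v` can be written in at most one
way as a Laurent polynomial in `x` and `y`. -/
lemma Represents.unique (hl : Even l) (hm : Even m) {α β : Cycle l m} (h : IsCycleBasis α β)
    {f f' : Laurent} {g : ℂ → ℂ → ℂ} (hf : Represents α β f g) (hf' : Represents α β f' g) :
    f = f' := by
  let χ : ℤ × ℤ → (ℂˣ × ℂˣ →* ℂ) := fun N => (Units.coeHom ℂ).comp
    (MonoidHom.fst ℂˣ ℂˣ ^ (exponent α β N).1 * MonoidHom.snd ℂˣ ℂˣ ^ (exponent α β N).2)
  have hχ : ∀ N (g : ℂˣ × ℂˣ), χ N g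
      = (g.1 : ℂ) ^ (exponent α β N).1 * (g.2 : ℂ) ^ (exponent α β N).2 := by
    intro N g
    simp [χ]
  have hinj : Function.Injective χ := by
    intro N N' hN
    have h2 : (2 : ℂ) ≠ 0 := two_ne_zero
    refine exponent_injective hl hm h (Prod.ext ?_ ?_)
    · have := DFunLike.congr_fun hN (Units.mk0 2 h2, 1)
      rw [hχ, hχ] at this
      exact zpow_left_two_injective (by simpa using this)
    · have := DFunLike.congr_fun hN (1, Units.mk0 2 h2)
      rw [hχ, hχ] at this
      exact zpow_left_two_injective (by simpa using this)
  have hli := (linearIndependent_monoidHom (ℂˣ × ℂˣ) ℂ).comp χ hinj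
  refine AddMonoidAlgebra.coeff_injective (hli ?_)
  have heval : ∀ (F : Laurent) (g : ℂˣ × ℂˣ),
      Finsupp.linearCombination ℂ ((fun f : ℂˣ × ℂˣ →* ℂ => (f : ℂˣ × ℂˣ → ℂ)) ∘ χ) F.coeff g
        = F.eval (α.monomial g.1 g.2) (β.monomial g.1 g.2) := by
    intro F g
    rw [Finsupp.linearCombination_apply, Laurent.eval, Finsupp.sum, Finsupp.sum,
      Finset.sum_apply]
    refine Finset.sum_congr rfl fun N _ => ?_
    rw [monomial_zpow_mul_monomial_zpow α β N g.1.ne_zero g.2.ne_zero, ← hχ]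
    rfl
  ext g
  rw [heval, heval, hf _ _ g.1.ne_zero g.2.ne_zero, hf' _ _ g.1.ne_zero g.2.ne_zero]

end Cycles

section LaurentSums

variable {ι : Type*}

/-- The Laurent polynomial with the terms `c i * x ^ (N i).1 * y ^ (N i).2`. -/
def laurentSum (P : Finset ι) (N : ι → ℤ × ℤ) (c : ι → ℂ) : Laurent :=
  ∑ i ∈ P, AddMonoidAlgebra.single (N i) (c i)

lemma eval_laurentSum (P : Finset ι) (N : ι → ℤ × ℤ) (c : ι → ℂ) (x y : ℂ) :
    (laurentSum P N c).eval x y = ∑ i ∈ P, c i * (x ^ (N i).1 * y ^ (N i).2) := by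
  rw [laurentSum, Laurent.eval, AddMonoidAlgebra.coeff_sum, ← Finsupp.sum_finsetSum_index]
  · refine Finset.sum_congr rfl fun i _ => ?_
    rw [AddMonoidAlgebra.coeff_single, Finsupp.sum_single_index (by simp)]
  · simp
  · intros
    ring

lemma isPolynomial_laurentSum {P : Finset ι} {N : ι → ℤ × ℤ} {c : ι → ℂ}
    (h : ∀ i ∈ P, 0 ≤ (N i).1 ∧ 0 ≤ (N i).2) : (laurentSum P N c).IsPolynomial := by
  intro n hn
  rw [laurentSum, AddMonoidAlgebra.coeff_sum] at hn
  obtain ⟨i, hi, hni⟩ := Finset.mem_biUnion.1 (Finsupp.support_finsetSum hn)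
  rw [AddMonoidAlgebra.coeff_single] at hni
  rw [Finset.mem_singleton.1 (Finsupp.support_single_subset hni)]
  exact h i hi

/-- The averages over the signs of `x` and `y` change the signs of exactly those terms in which the
exponents of `x` and `y` are not both even. This includes `x = 0` and `y = 0`, where negative powers
are `0`. -/
lemma mul_zpow_eq_average {c c' : ℂ} {N : ℤ × ℤ} (heven : Even N.1 → Even N.2 → c = c')
    (hodd : ¬ (Even N.1 ∧ Even N.2) → c = -c') (x y : ℂ) :
    c * (x ^ N.1 * y ^ N.2)
      = (1 / 2) * (-(c' * (x ^ N.1 * y ^ N.2)) + c' * ((-x) ^ N.1 * y ^ N.2)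
        + c' * (x ^ N.1 * (-y) ^ N.2) + c' * ((-x) ^ N.1 * (-y) ^ N.2)) := by
  rcases Int.even_or_odd N.1 with h1 | h1 <;> rcases Int.even_or_odd N.2 with h2 | h2
  · rw [heven h1 h2, h1.neg_zpow, h2.neg_zpow]
    ring
  · rw [hodd fun h => (Int.not_even_iff_odd.2 h2) h.2, h1.neg_zpow, h2.neg_zpow]
    ring
  · rw [hodd fun h => (Int.not_even_iff_odd.2 h1) h.1, h1.neg_zpow, h2.neg_zpow]
    ring
  · rw [hodd fun h => (Int.not_even_iff_odd.2 h1) h.1, h1.neg_zpow, h2.neg_zpow]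
    ring

lemma eval_laurentSum_eq_average {P : Finset ι} {N : ι → ℤ × ℤ} {c c' : ι → ℂ}
    (heven : ∀ i ∈ P, Even (N i).1 → Even (N i).2 → c i = c' i)
    (hodd : ∀ i ∈ P, ¬ (Even (N i).1 ∧ Even (N i).2) → c i = -c' i) (x y : ℂ) :
    (laurentSum P N c).eval x y = (1 / 2) * (-(laurentSum P N c').eval x y
      + (laurentSum P N c').eval (-x) y + (laurentSum P N c').eval x (-y)
      + (laurentSum P N c').eval (-x) (-y)) := by
  simp only [eval_laurentSum]
  rw [← Finset.sum_neg_distrib, ← Finset.sum_add_distrib, ← Finset.sum_add_distrib,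
    ← Finset.sum_add_distrib, Finset.mul_sum]
  exact Finset.sum_congr rfl fun i hi => mul_zpow_eq_average (heven i hi) (hodd i hi) x y

end LaurentSums

/-! ### The terms as monomials in the two cycles -/

section TermsOfConfigurations

variable {l m : ℕ} [NeZero l] [NeZero m]

/-- The part of the term of a dimer configuration that does not depend on `u` and `v`, up to
sign. -/
def configurationFactor (w : Link l m → ℂ) (k : White l m → Kind) : ℂ :=
  ∏ p, linkFactor w p (k p)

lemma prod_linkFactor_mul (w : Link l m → ℂ) (k : White l m → Kind) {u v : ℂ} (hu : u ≠ 0)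
    (hv : v ≠ 0) :
    ∏ p, linkFactor w p (k p) * (u ^ (k p).degree.1 * v ^ (k p).degree.2)
      = configurationFactor w k * (u ^ (∑ p, (k p).degree.1) * v ^ (∑ p, (k p).degree.2)) := by
  have hprod : ∀ {z : ℂ}, z ≠ 0 → ∀ c : White l m → ℤ, ∏ p, z ^ c p = z ^ ∑ p, c p := by
    intro z hz c
    have := congrArg (Units.val : ℂˣ → ℂ)
      (prod_zpow_eq_zpow_sum Finset.univ (Units.mk0 z hz) c)
    simpa using this
  rw [Finset.prod_mul_distrib, Finset.prod_mul_distrib, hprod hu, hprod hv, configurationFactor]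

/-- The sign of a dimer configuration in the statistical sum. -/
def dimerSign (k : White l m → Kind) : ℤˣ :=
  ∏ p, if k p = Kind.B then 1 else -1

/-- The term of a dimer configuration is the monomial `x ^ N.1 * y ^ N.2` for the coordinates `N` of
the homology class of its closed paths, and its signs in the determinant and in the statistical sum
agree if and only if `N` is even. -/
lemma IsCompatible.exists_exponent (hl : Even l) (hm : Even m) {α β : Cycle l m}
    (hαβ : IsCycleBasis α β) {σ : Perm (White l m)} {k : White l m → Kind}
    (h : IsCompatible σ k) :
    ∃ N : ℤ × ℤ, exponent α β N = (∑ p, (k p).degree.1, ∑ p, (k p).degree.2) ∧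
      (Even N.1 → Even N.2 → Perm.sign σ = dimerSign k) ∧
      (¬ (Even N.1 ∧ Even N.2) → Perm.sign σ = -dimerSign k) := by
  obtain ⟨n, r, hn, hr, hs⟩ := h.exists_winding hl hm
  obtain ⟨δ, hδ, hδδ⟩ : ∃ δ : ℤ, intersectionNumber α β = δ ∧ δ * δ = 1 := by
    refine ⟨_, rfl, ?_⟩
    rcases (abs_eq (by norm_num)).1 hαβ with h | h <;> rw [h] <;> norm_num
  rw [intersectionNumber] at hδ
  -- Cramer's rule for the homology class `(r, -n)` in terms of those of `α` and `β`.
  obtain ⟨N, hN1, hN2⟩ : ∃ N : ℤ × ℤ,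
      α.homologyClass.1 * N.1 + β.homologyClass.1 * N.2 = r ∧
      α.homologyClass.2 * N.1 + β.homologyClass.2 * N.2 = -n := by
    refine ⟨(δ * (r * β.homologyClass.2 + n * β.homologyClass.1),
      δ * (-n * α.homologyClass.1 - r * α.homologyClass.2)), ?_, ?_⟩
    · linear_combination r * hδδ + δ * r * hδ
    · linear_combination -n * hδδ - δ * n * hδ
  have hN1' : N.1 = δ * (r * β.homologyClass.2 + n * β.homologyClass.1) := by
    linear_combination -N.1 * hδδ - δ * N.1 * hδ
      + δ * β.homologyClass.2 * hN1 - δ * β.homologyClass.1 * hN2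
  have hN2' : N.2 = δ * (-n * α.homologyClass.1 - r * α.homologyClass.2) := by
    linear_combination -N.2 * hδδ - δ * N.2 * hδ
      + δ * α.homologyClass.1 * hN2 - δ * α.homologyClass.2 * hN1
  have heven : Even N.1 ∧ Even N.2 ↔ Even n ∧ Even r := by
    constructor
    · rintro ⟨h1, h2⟩
      constructor
      · rw [← Int.even_coe_nat, ← even_neg, ← hN2]
        exact (h1.mul_left _).add (h2.mul_left _)
      · rw [← hN1]
        exact (h1.mul_left _).add (h2.mul_left _)
    · rintro ⟨h1, h2⟩
      have h1' : Even (n : ℤ) := (Int.even_coe_nat n).2 h1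
      rw [hN1', hN2']
      exact ⟨((h2.mul_right _).add (h1'.mul_right _)).mul_left _,
        ((h1'.neg.mul_right _).sub (h2.mul_right _)).mul_left _⟩
  have hsign : ∀ ε : ℤˣ, Perm.sign σ * dimerSign k = ε → Perm.sign σ = ε * dimerSign k := by
    rintro _ rfl
    rw [mul_assoc, Int.units_mul_self, mul_one]
  refine ⟨N, ?_, fun h1 h2 => ?_, fun h12 => ?_⟩
  · have h2 := two_mul_exponent hl hm α β N
    rw [hN1, hN2] at h2
    refine Prod.ext ?_ ?_
    · change (exponent α β N).1 = ∑ p, (k p).degree.1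
      linarith [h2.1]
    · change (exponent α β N).2 = ∑ p, (k p).degree.2
      linarith [h2.2]
  · obtain ⟨h3, h4⟩ := heven.1 ⟨h1, h2⟩
    rw [← one_mul (dimerSign k)]
    refine hsign _ (hs.trans ?_)
    rw [h3.neg_one_pow, h4.neg_one_zpow, one_pow, mul_one]
  · rw [heven] at h12
    rw [neg_eq_neg_one_mul]
    refine hsign _ (hs.trans ?_)
    rcases Nat.even_or_odd n with h3 | h3
    · have h4 : Odd r := Int.not_even_iff_odd.1 fun h4 => h12 ⟨h3, h4⟩
      rw [h3.neg_one_pow, h4.neg_one_zpow, h3.add_one.neg_one_pow, one_mul]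
    · obtain ⟨j, hj⟩ := h3.add_one
      rw [h3.neg_one_pow, hj, ← two_mul, pow_mul, Int.units_sq, one_pow, mul_one]

/-- Laurent polynomials with the same exponents represent the determinant and the normalized
statistical sum. -/
lemma exists_laurentSum (hl : Even l) (hm : Even m) {α β : Cycle l m} (hαβ : IsCycleBasis α β) :
    ∃ N : Perm (White l m) × (White l m → Kind) → ℤ × ℤ,
      (∀ i ∈ configurations l m,
        exponent α β (N i) = (∑ p, (i.2 p).degree.1, ∑ p, (i.2 p).degree.2) ∧
        (Even (N i).1 → Even (N i).2 → Perm.sign i.1 = dimerSign i.2) ∧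
        (¬ (Even (N i).1 ∧ Even (N i).2) → Perm.sign i.1 = -dimerSign i.2)) ∧
      ∀ w : Link l m → ℂ, (∀ p : White l m, w (p, Kind.B) ≠ 0) →
        Represents α β (laurentSum (configurations l m) N
          fun i => ((Perm.sign i.1 : ℤ) : ℂ) * configurationFactor w i.2) (determinant w) ∧
        Represents α β (laurentSum (configurations l m) N
          fun i => ((dimerSign i.2 : ℤ) : ℂ) * configurationFactor w i.2) (normalizedSum w) := by
  choose! N hN using fun (i : Perm (White l m) × (White l m → Kind))
    (hi : i ∈ configurations l m) =>
      (mem_configurations.1 hi).exists_exponent hl hm hαβ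
  refine ⟨N, hN, fun w hw => ⟨fun u v hu hv => ?_, fun u v hu hv => ?_⟩⟩
  · rw [eval_laurentSum, determinant_eq_sum hm]
    refine Finset.sum_congr rfl fun i hi => ?_
    rw [monomial_zpow_mul_monomial_zpow α β _ hu hv, (hN i hi).1, prod_linkFactor_mul w _ hu hv,
      mul_assoc]
  · rw [eval_laurentSum, normalizedSum_eq_sum hl hm w hw]
    refine Finset.sum_congr rfl fun i hi => ?_
    rw [monomial_zpow_mul_monomial_zpow α β _ hu hv, (hN i hi).1, prod_linkFactor_mul w _ hu hv,
      mul_assoc, dimerSign]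

/-- With respect to cycles of the homology classes `(-m, -1)` and `(1, 0)` all exponents are
nonnegative: the class `(r, -n)` has the coordinates `n` and `r + m * n`, and `l * r ≥ -m * n`. -/
lemma nonneg_of_exponent_eq (hl : Even l) (hm : Even m) {α β : Cycle l m}
    (hα : α.homologyClass = (-(m : ℤ), -1)) (hβ : β.homologyClass = (1, 0)) {N : ℤ × ℤ}
    {k : White l m → Kind}
    (hN : exponent α β N = (∑ p, (k p).degree.1, ∑ p, (k p).degree.2)) :
    0 ≤ N.1 ∧ 0 ≤ N.2 := by
  have h := two_mul_exponent hl hm α β N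
  have hdeg : ∀ κ : Kind, 0 ≤ κ.degree.1 ∧ 0 ≤ κ.degree.2 := by
    intro κ
    cases κ <;> simp [Kind.degree]
  have h1 : 0 ≤ (exponent α β N).1 := by
    rw [hN]
    exact Finset.sum_nonneg fun p _ => (hdeg (k p)).1
  have h2 : 0 ≤ (exponent α β N).2 := by
    rw [hN]
    exact Finset.sum_nonneg fun p _ => (hdeg (k p)).2
  simp only [hα, hβ] at h
  have hm0 : (0 : ℤ) < m := by exact_mod_cast Nat.pos_of_ne_zero (NeZero.ne m)
  have hl1 : (1 : ℤ) ≤ l := by exact_mod_cast Nat.one_le_iff_ne_zero.2 (NeZero.ne l)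
  have hN1 : 0 ≤ N.1 := by
    by_contra hcon
    nlinarith [h.1, h.2]
  have hmN : 0 ≤ (m : ℤ) * N.1 := mul_nonneg hm0.le hN1
  refine ⟨hN1, ?_⟩
  by_contra hcon
  push Not at hcon
  have h3 : 0 ≤ (l : ℤ) * (-m * N.1 + N.2) + m * N.1 := by linarith [h.1]
  have h4 : (l : ℤ) * N.2 < 0 := mul_neg_of_pos_of_neg (by linarith) hcon
  have h5 : (m : ℤ) * N.1 ≤ l * (m * N.1) := le_mul_of_one_le_left hmN hl1
  linarith

end TermsOfConfigurations

end DimerTorus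

end

open DimerTorus in
theorem lemmal3 (l m : ℕ) [NeZero l] [NeZero m] (hl : Even l) (hm : Even m) :
    (∀ w : Link l m → ℂ, (∀ p : White l m, w (p, Kind.B) ≠ 0) →
      ∀ α β : Cycle l m, IsCycleBasis α β →
        (∃! f : Laurent, Represents α β f (determinant w)) ∧
        (∃! s : Laurent, Represents α β s (normalizedSum w)) ∧
        ∀ f s : Laurent, Represents α β f (determinant w) →
          Represents α β s (normalizedSum w) →
          ∀ x y : ℂ,
            s.eval x y
              = (1 / 2) * (-f.eval x y + f.eval (-x) y + f.eval x (-y) + f.eval (-x) (-y)) ∧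
            f.eval x y
              = (1 / 2) * (-s.eval x y + s.eval (-x) y + s.eval x (-y) + s.eval (-x) (-y))) ∧
    (∃ α β : Cycle l m, IsCycleBasis α β ∧
      ∀ w : Link l m → ℂ, (∀ p : White l m, w (p, Kind.B) ≠ 0) →
        ∀ f s : Laurent, Represents α β f (determinant w) →
          Represents α β s (normalizedSum w) → f.IsPolynomial ∧ s.IsPolynomial) := by
  constructor
  · intro w hw α β hαβ
    obtain ⟨N, hN, hrep⟩ := exists_laurentSum hl hm hαβ
    obtain ⟨hF, hS⟩ := hrep w hw
    refine ⟨⟨_, hF, fun f hf => hf.unique hl hm hαβ hF⟩,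
      ⟨_, hS, fun s hs => hs.unique hl hm hαβ hS⟩, fun f s hf hs x y => ?_⟩
    rw [hf.unique hl hm hαβ hF, hs.unique hl hm hαβ hS]
    constructor
    · refine eval_laurentSum_eq_average (fun i hi h1 h2 => ?_) (fun i hi h12 => ?_) x y
      · rw [(hN i hi).2.1 h1 h2]
      · rw [(hN i hi).2.2 h12]
        simp
    · refine eval_laurentSum_eq_average (fun i hi h1 h2 => ?_) (fun i hi h12 => ?_) x y
      · rw [(hN i hi).2.1 h1 h2]
      · rw [(hN i hi).2.2 h12]
        simp
  · obtain ⟨α, hα⟩ := Cycle.exists_homologyClass_eq hl hm (-m) (-1)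
    obtain ⟨β, hβ⟩ := Cycle.exists_homologyClass_eq hl hm 1 0
    have hαβ : IsCycleBasis α β := by simp [IsCycleBasis, intersectionNumber, hα, hβ]
    refine ⟨α, β, hαβ, fun w hw f s hf hs => ?_⟩
    obtain ⟨N, hN, hrep⟩ := exists_laurentSum hl hm hαβ
    obtain ⟨hF, hS⟩ := hrep w hw
    have hnonneg := fun i hi => nonneg_of_exponent_eq hl hm hα hβ (hN i hi).1
    rw [hf.unique hl hm hαβ hF, hs.unique hl hm hαβ hS]
    exact ⟨isPolynomial_laurentSum hnonneg, isPolynomial_laurentSum hnonneg⟩
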